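/- **Setting.** All manifolds (Hausdorff, finite-dimensional, without boundary) and maps are smooth. Let $Q$ be a manifold, $L:TQ\to\mathbb R$ a regular Lagrangian (the fibre Hessian $\partial^2L/\partial\dot q\,\partial\dot q$ is everywhere nondegenerate), $\xi_0$ a vector field on $Q$ and $\mathcal D_0$ a distribution of constant rank on $Q$, and let $$M_0=\{v_q\in TQ:\ v_q-\xi_0(q)\in(\mathcal D_0)_q\}.$$ Let $X_{L,Q,M_0}$ be the corresponding time-independent nonholonomic system with affine constraints, i.e. a vector field on $M_0$ (tangent to $M_0$) given by the restriction to $M_0$ of Lagrange equations $\dot q=v$, $\frac{d}{dt}\frac{\partial L}{\partial\dot q}-\frac{\partial L}{\partial q}=R$ for some reaction force $R$ on $M_0$ with values in the annihilator $\mathcal D_0^\circ\subset T^*Q$. Let $p(v_q)\in T_q^*Q$ be the derivative at $v_q$ of $L|_{T_qQ}$ (in coordinates $p=\partial L/\partial\dot q$), and let $E_L(v_q)=\langle p(v_q),v_q\rangle-L(v_q)$ be the energy; for a time-dependent Lagrangian on $TQ\times\mathbb R$ the energy is defined in the same way at each fixed $t$. A time-dependent diffeomorphism of $Q$ is a diffeomorphism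 $\mathcal C$ of $Q\times\mathbb R$ of the form $\mathcal C(q,t)=(\mathcal Q_t(q),t)$; it induces the bijection $D\mathcal C(v_q,t)=\big(T_q\mathcal Q_t\cdot v_q+\frac{\partial}{\partial t}\mathcal Q_t(q),\,t\big)$ of $TQ\times\mathbb R$. The moving energy induced by $\mathcal C$ is the restriction to $M_0\times\mathbb R$ of $E^*_{L,\mathcal C}:=E_{L\circ D\mathcal C}\circ D\mathcal C^{-1}:TQ\times\mathbb R\to\mathbb R$, where $L$ is regarded as a function on $TQ\times\mathbb R$ that does not depend on $t$. Let $\Psi:G\times Q\to Q$ be a smooth action of a Lie group $G$ with Lie algebra $\mathfrak g$. For $\eta\in\mathfrak g$ let $Y_\eta(q)=\frac{d}{dt}\Psi_{\exp(t\eta)}(q)|_{t=0}$ be the infinitesimal generator and $J_\eta(v_q)=\langle p(v_q),Y_\eta(q)\rangle$. **Theorem 2.** Assume that * (H1) $L(T_q\Psi_g\cdot v_q)=L(v_q)$ for all $g\in G$, $q\in Q$ and $v_q\in T_qQ$; * (H2) $(\mathcal D_0)_{\Psi_g(q)}=T_q\Psi_g\cdot(\mathcal D_0)_q$ for all $g\in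 G$ and $q\in Q$; * (H3) $\eta\in\mathfrak g$ is such that $Y_\eta-\xi_0$ is a section of $\mathcal D_0$. Then the restriction of $E_L-J_\eta$ to $M_0$ is a (time-independent) first integral of $X_{L,Q,M_0}$: it is smooth and constant along all integral curves of $X_{L,Q,M_0}$. Moreover, it is the moving energy induced by the flow of $Y_\eta$: there is exactly one time-dependent diffeomorphism $\mathcal C_\eta=(\Phi^{Y_\eta},\mathrm{id}_{\mathbb R})$ of $Q$ whose first component $\Phi^{Y_\eta}$ is the flow of $Y_\eta$, and $E^*_{L,\mathcal C_\eta}(v,t)=E_L(v)-J_\eta(v)$ for all $v\in TQ$ and $t\in\mathbb R$. -/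

import Mathlib

open scoped Manifold ContDiff Topology

noncomputable section

namespace MovingEnergy

section Lagrangian

variable {E : Type*} [NormedAddCommGroup E] [NormedSpace ℝ E]
  {H : Type*} [TopologicalSpace H] {I : ModelWithCorners ℝ E H}
  {Q : Type*} [TopologicalSpace Q] [ChartedSpace H Q]

/-- The momentum covector `p(v) ∈ T_q^* Q` of a Lagrangian `L` on `TQ`, at `v ∈ T_q Q`: the
derivative at `v` of the restriction of `L` to the vector space `T_q Q`
(in bundle coordinates, `∂L/∂q̇`). -/
def momentum (L : TangentBundle I Q → ℝ) (v : TangentBundle I Q) :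
    TangentSpace I v.proj →L[ℝ] ℝ :=
  fderiv ℝ (fun w : E ↦ L ⟨v.proj, w⟩) v.snd

/-- The energy `E_L(v) = ⟨p(v), v⟩ - L(v)` of a Lagrangian on `TQ`. -/
def energy (L : TangentBundle I Q → ℝ) (v : TangentBundle I Q) : ℝ :=
  momentum L v v.snd - L v

/-- The energy `E_L(v, t) = ⟨p(v, t), v⟩ - L(v, t)` of a time-dependent Lagrangian on `TQ × ℝ`. -/
def extendedEnergy (L : TangentBundle I Q × ℝ → ℝ) (z : TangentBundle I Q × ℝ) : ℝ :=
  energy (fun v ↦ L (v, z.2)) z.1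

/-- A Lagrangian is regular if its fibre Hessian `∂²L/∂q̇∂q̇` is everywhere nondegenerate. -/
def IsRegular (L : TangentBundle I Q → ℝ) : Prop :=
  ∀ (q : Q) (v u : E),
    (∀ w : E, fderiv ℝ (fderiv ℝ fun x : E ↦ L (⟨q, x⟩ : TangentBundle I Q)) v u w = 0) → u = 0

/-- A smooth distribution of constant rank `r`: it is locally spanned by `r` smooth vector
fields, and its fibres have dimension `r`. -/
structure IsSmoothDistribution (D : ∀ q : Q, Submodule ℝ (TangentSpace I q)) (r : ℕ)
    [IsManifold I 1 Q] : Prop where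
  finrank_eq : ∀ q, Module.finrank ℝ (D q) = r
  exists_frame : ∀ q : Q, ∃ U : Set Q, IsOpen U ∧ q ∈ U ∧
    ∃ e : Fin r → ∀ x : Q, TangentSpace I x,
      (∀ i, ContMDiffOn I I.tangent ∞ (fun x ↦ (⟨x, e i x⟩ : TangentBundle I Q)) U) ∧
      ∀ x ∈ U, D x = Submodule.span ℝ (Set.range fun i ↦ e i x)

/-- The constraint submanifold `M₀ = {v_q : v_q - ξ₀(q) ∈ (D₀)_q}` of `TQ`. -/
def constraintSubmanifold (ξ : ∀ q : Q, TangentSpace I q)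
    (D : ∀ q : Q, Submodule ℝ (TangentSpace I q)) : Set (TangentBundle I Q) :=
  {v | v.snd - ξ v.proj ∈ D v.proj}

variable [IsManifold I 1 Q]

/-- `L` in the bundle coordinates `(x, ẋ) ∈ E × E` of `TQ` induced by the chart of `Q` around the
base point of `v`. -/
def coordLagrangian (L : TangentBundle I Q → ℝ) (v : TangentBundle I Q) : E × E → ℝ :=
  L ∘ (extChartAt I.tangent v).symm

/-- The left-hand side `(d/dt) ∂L/∂q̇ - ∂L/∂q` of Lagrange equations at `v ∈ T_q Q`, where `d/dt` is
the derivative along the tangent vector `a ∈ T_v TQ`, as a covector at `q`. It is computed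
in the bundle coordinates around `v`, and moved to `T_q Q` by the differential of the chart. -/
def lagrangeCovector (L : TangentBundle I Q → ℝ) (v : TangentBundle I Q)
    (a : TangentSpace I.tangent v) : TangentSpace I v.proj →L[ℝ] ℝ :=
  let z : E × E := extChartAt I.tangent v v
  let dz : E × E := mfderiv I.tangent 𝓘(ℝ, E × E) (extChartAt I.tangent v) v a
  let p : E × E → E →L[ℝ] ℝ := fun y ↦
    (fderiv ℝ (coordLagrangian L v) y).comp (ContinuousLinearMap.inr ℝ E E)
  let force : E →L[ℝ] ℝ :=
    fderiv ℝ p z dz - (fderiv ℝ (coordLagrangian L v) z).comp (ContinuousLinearMap.inl ℝ E E)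
  force.comp (mfderiv I 𝓘(ℝ, E) (extChartAt I v.proj) v.proj)

/-- `a ∈ T_v TQ` is tangent at `v` to the subset `M` of `TQ`: it is the velocity of a smooth curve
in `M` through `v`. -/
def IsTangentTo (M : Set (TangentBundle I Q)) (v : TangentBundle I Q)
    (a : TangentSpace I.tangent v) : Prop :=
  ∃ c : ℝ → TangentBundle I Q, ContMDiffAt 𝓘(ℝ, ℝ) I.tangent ∞ c 0 ∧ c 0 = v ∧
    (∀ᶠ s in 𝓝 (0 : ℝ), c s ∈ M) ∧
    HasMFDerivAt 𝓘(ℝ, ℝ) I.tangent c 0 ((1 : ℝ →L[ℝ] ℝ).smulRight a)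

end Lagrangian

/-- The data of a time-independent nonholonomic system with affine constraints: a regular
Lagrangian `L` on `TQ` and an affine distribution `ξ + D` on `Q`. -/
structure NonholonomicData {E : Type*} [NormedAddCommGroup E] [NormedSpace ℝ E]
    {H : Type*} [TopologicalSpace H] (I : ModelWithCorners ℝ E H)
    (Q : Type*) [TopologicalSpace Q] [ChartedSpace H Q] [IsManifold I ∞ Q] where
  /-- the Lagrangian -/
  L : TangentBundle I Q → ℝ
  smooth_L : ContMDiff I.tangent 𝓘(ℝ, ℝ) ∞ L
  regular_L : IsRegular L
  /-- the nonhomogeneous part of the constraint -/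
  ξ : ∀ q : Q, TangentSpace I q
  smooth_ξ : ContMDiff I I.tangent ∞ fun q ↦ (⟨q, ξ q⟩ : TangentBundle I Q)
  /-- the constraint distribution -/
  D : ∀ q : Q, Submodule ℝ (TangentSpace I q)
  /-- the rank of the constraint distribution -/
  rank : ℕ
  smooth_D : IsSmoothDistribution D rank

section System

variable {E : Type*} [NormedAddCommGroup E] [NormedSpace ℝ E]
  {H : Type*} [TopologicalSpace H] {I : ModelWithCorners ℝ E H}
  {Q : Type*} [TopologicalSpace Q] [ChartedSpace H Q] [IsManifold I ∞ Q]

/-- The constraint submanifold of the system. -/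
def NonholonomicData.M₀ (S : NonholonomicData I Q) : Set (TangentBundle I Q) :=
  constraintSubmanifold S.ξ S.D

/-- `X` is the vector field on `M₀` given by the restriction to `M₀` of Lagrange equations
with an ideal reaction force. Only the values of `X` on `M₀` matter. -/
structure NonholonomicData.IsNonholonomicSystem (S : NonholonomicData I Q)
    (X : ∀ v : TangentBundle I Q, TangentSpace I.tangent v) : Prop where
  smooth : ContMDiffOn I.tangent I.tangent.tangent ∞
    (fun v ↦ (⟨v, X v⟩ : TangentBundle I.tangent (TangentBundle I Q))) S.M₀
  tangent : ∀ v ∈ S.M₀, IsTangentTo S.M₀ v (X v)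
  /-- `X` is a second-order vector field: the base point `q` of `v ∈ T_q Q` has velocity `v`. -/
  second_order : ∀ v ∈ S.M₀,
    mfderiv I.tangent I (fun w : TangentBundle I Q ↦ w.proj) v (X v) = v.snd
  /-- Lagrange equations with a reaction force `R : M₀ → D°`. -/
  lagrange : ∃ R : ∀ v : TangentBundle I Q, TangentSpace I v.proj →L[ℝ] ℝ,
    ∀ v ∈ S.M₀, (∀ w ∈ S.D v.proj, R v w = 0) ∧ lagrangeCovector S.L v (X v) = R v

/-- The restriction of `f` to the subset `M` of `TQ` is a first integral of the vector field `X` on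
`M`: it is smooth and it is constant along each integral curve of `X` in `M`, on any interval
`s`. -/
def IsFirstIntegral (M : Set (TangentBundle I Q))
    (X : ∀ v : TangentBundle I Q, TangentSpace I.tangent v) (f : TangentBundle I Q → ℝ) : Prop :=
  ContMDiffOn I.tangent 𝓘(ℝ, ℝ) ∞ f M ∧
    ∀ (γ : ℝ → TangentBundle I Q) (s : Set ℝ), s.OrdConnected →
      IsMIntegralCurveOn γ X s → (∀ t ∈ s, γ t ∈ M) →
        ∀ t₁ ∈ s, ∀ t₂ ∈ s, f (γ t₁) = f (γ t₂)

end System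

section Diffeo

/-- A time-dependent diffeomorphism of `U` onto `Q`: a diffeomorphism
`U × ℝ → Q × ℝ` of the form `(u, t) ↦ (𝒬(u, t), t)`. -/
@[ext]
structure TimeDependentDiffeo
    {E' : Type*} [NormedAddCommGroup E'] [NormedSpace ℝ E']
    {H' : Type*} [TopologicalSpace H'] (I' : ModelWithCorners ℝ E' H')
    {E : Type*} [NormedAddCommGroup E] [NormedSpace ℝ E]
    {H : Type*} [TopologicalSpace H] (I : ModelWithCorners ℝ E H)
    (U : Type*) [TopologicalSpace U] [ChartedSpace H' U]
    (Q : Type*) [TopologicalSpace Q] [ChartedSpace H Q] where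
  /-- the diffeomorphism of the extended spaces -/
  toDiffeo : Diffeomorph (I'.prod 𝓘(ℝ, ℝ)) (I.prod 𝓘(ℝ, ℝ)) (U × ℝ) (Q × ℝ) ∞
  time_eq : ∀ z, (toDiffeo z).2 = z.2

variable {E' : Type*} [NormedAddCommGroup E'] [NormedSpace ℝ E']
  {H' : Type*} [TopologicalSpace H'] {I' : ModelWithCorners ℝ E' H'}
  {E : Type*} [NormedAddCommGroup E] [NormedSpace ℝ E]
  {H : Type*} [TopologicalSpace H] {I : ModelWithCorners ℝ E H}
  {U : Type*} [TopologicalSpace U] [ChartedSpace H' U]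
  {Q : Type*} [TopologicalSpace Q] [ChartedSpace H Q]

namespace TimeDependentDiffeo

/-- The first component `𝒬 : U × ℝ → Q`. -/
def map (C : TimeDependentDiffeo I' I U Q) (u : U) (t : ℝ) : Q := (C.toDiffeo (u, t)).1

/-- The inverse time-dependent diffeomorphism. -/
def symm (C : TimeDependentDiffeo I' I U Q) : TimeDependentDiffeo I I' Q U where
  toDiffeo := C.toDiffeo.symm
  time_eq z := by
    rw [← C.time_eq (C.toDiffeo.symm z), C.toDiffeo.apply_symm_apply]

/-- The map `DC(v_u, t) = (T_u 𝒬_t · v_u + ∂𝒬/∂t (u, t), t)`. -/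
def lift (C : TimeDependentDiffeo I' I U Q) (z : TangentBundle I' U × ℝ) :
    TangentBundle I Q × ℝ :=
  (⟨C.map z.1.proj z.2,
    mfderiv I' I (fun u ↦ C.map u z.2) z.1.proj z.1.snd +
      mfderiv 𝓘(ℝ, ℝ) I (fun t ↦ C.map z.1.proj t) z.2 (1 : ℝ)⟩, z.2)

theorem lift_fst_eq_tangentMap (C : TimeDependentDiffeo I' I U Q) (z : TangentBundle I' U × ℝ) :
    (C.lift z).1 = tangentMap (I'.prod 𝓘(ℝ, ℝ)) I (fun y ↦ (C.toDiffeo y).1)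
      ⟨(z.1.proj, z.2), (z.1.snd, (1 : ℝ))⟩ := by
  have h : MDifferentiableAt (I'.prod 𝓘(ℝ, ℝ)) I (fun y ↦ (C.toDiffeo y).1) (z.1.proj, z.2) :=
    ((contMDiff_fst.comp C.toDiffeo.contMDiff_toFun).mdifferentiable (by simp)) _
  have h2 := mfderiv_prod_eq_add_apply
    (v := ((z.1.snd, (1 : ℝ)) : TangentSpace (I'.prod 𝓘(ℝ, ℝ)) (z.1.proj, z.2))) h
  exact congrArg (fun w ↦ (⟨_, w⟩ : TangentBundle I Q)) h2.symm

theorem tangentMap_toDiffeo (C : TimeDependentDiffeo I' I U Q) (z : TangentBundle I' U × ℝ) :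
    tangentMap (I'.prod 𝓘(ℝ, ℝ)) (I.prod 𝓘(ℝ, ℝ)) C.toDiffeo
      ⟨(z.1.proj, z.2), (z.1.snd, (1 : ℝ))⟩ =
      ⟨((C.lift z).1.proj, (C.lift z).2), ((C.lift z).1.snd, (1 : ℝ))⟩ := by
  have h : MDifferentiableAt (I'.prod 𝓘(ℝ, ℝ)) I (fun y ↦ (C.toDiffeo y).1) (z.1.proj, z.2) :=
    ((contMDiff_fst.comp C.toDiffeo.contMDiff_toFun).mdifferentiable (by simp)) _
  have hfun : ⇑C.toDiffeo = fun y : U × ℝ ↦ ((C.toDiffeo y).1, y.2) :=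
    funext fun y ↦ Prod.ext rfl (C.time_eq y)
  have h2 := mfderiv_prodMk h
    (mdifferentiableAt_snd : MDifferentiableAt (I'.prod 𝓘(ℝ, ℝ)) 𝓘(ℝ, ℝ) (Prod.snd : U × ℝ → ℝ) _)
  have h3 := congrArg (fun w : TangentBundle I Q ↦
    (⟨(w.proj, z.2), (w.snd, (1 : ℝ))⟩ :
      TangentBundle (I.prod 𝓘(ℝ, ℝ)) (Q × ℝ))) (C.lift_fst_eq_tangentMap z)
  refine Eq.trans ?_ h3.symm
  rw [hfun]
  simp only [tangentMap]
  refine congrArg (fun w ↦ (⟨_, w⟩ : TangentBundle (I.prod 𝓘(ℝ, ℝ)) (Q × ℝ))) ?_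
  rw [h2, mfderiv_snd]
  rfl

theorem symm_lift_lift (C : TimeDependentDiffeo I' I U Q) (z : TangentBundle I' U × ℝ) :
    C.symm.lift (C.lift z) = z := by
  refine Prod.ext ?_ rfl
  rw [lift_fst_eq_tangentMap, ← tangentMap_toDiffeo]
  have h1 : MDifferentiable (I'.prod 𝓘(ℝ, ℝ)) (I.prod 𝓘(ℝ, ℝ)) C.toDiffeo :=
    C.toDiffeo.contMDiff_toFun.mdifferentiable (by simp)
  have h2 : MDifferentiable (I.prod 𝓘(ℝ, ℝ)) I' (fun y ↦ (C.symm.toDiffeo y).1) :=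
    (contMDiff_fst.comp C.symm.toDiffeo.contMDiff_toFun).mdifferentiable (by simp)
  rw [← tangentMap_comp_at _ (h2 _) (h1 _)]
  have h3 : (fun y ↦ (C.symm.toDiffeo y).1) ∘ C.toDiffeo = (Prod.fst : U × ℝ → U) := by
    funext y
    exact congrArg Prod.fst (C.toDiffeo.symm_apply_apply y)
  rw [h3, tangentMap_prodFst]

/-- `DC` as a bijection; its inverse is the lift of the inverse of `C`. -/
def liftEquiv (C : TimeDependentDiffeo I' I U Q) :
    TangentBundle I' U × ℝ ≃ TangentBundle I Q × ℝ where
  toFun := C.lift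
  invFun := C.symm.lift
  left_inv := C.symm_lift_lift
  right_inv := C.symm.symm_lift_lift

end TimeDependentDiffeo

/-- The moving energy `E_{L,C}^* = E_{L ∘ DC} ∘ DC⁻¹` induced by `C`, before restriction to the
constraint manifold. -/
def movingEnergy (L : TangentBundle I Q × ℝ → ℝ) (C : TimeDependentDiffeo I' I U Q) :
    TangentBundle I Q × ℝ → ℝ :=
  extendedEnergy (L ∘ C.liftEquiv) ∘ C.liftEquiv.symm

/-- `Φ : Q × ℝ → Q` is the (global) flow of the vector field `Y`. -/
def IsFlow (Φ : Q → ℝ → Q) (Y : ∀ q : Q, TangentSpace I q) : Prop :=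
  ∀ q, Φ q 0 = q ∧ IsMIntegralCurve (Φ q) Y

end Diffeo

section Action

variable {F : Type*} [NormedAddCommGroup F] [NormedSpace ℝ F]
  {K : Type*} [TopologicalSpace K] {J : ModelWithCorners ℝ F K}
  {G : Type*} [TopologicalSpace G] [ChartedSpace K G] [Group G]

open Classical in
/-- The exponential map of a Lie group: `exp η = γ(1)`, where `γ` is the integral curve, with
`γ(0) = 1`, of the left-invariant vector field that equals `η` at the identity. (In a Hausdorff
Lie group `γ` exists and is unique.) -/
def lieExp (η : GroupLieAlgebra J G) : G :=
  if h : ∃ γ : ℝ → G, γ 0 = 1 ∧ IsMIntegralCurve γ (mulInvariantVectorField η) then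
    h.choose 1
  else 1

variable {E : Type*} [NormedAddCommGroup E] [NormedSpace ℝ E]
  {H : Type*} [TopologicalSpace H] (I : ModelWithCorners ℝ E H)
  {Q : Type*} [TopologicalSpace Q] [ChartedSpace H Q] [MulAction G Q]

/-- The infinitesimal generator `Y_η(q) = (d/dt) Ψ_{exp(tη)}(q)` at `t = 0`. The derivative is a
tangent vector at `exp(0) • q`, which is the point `q`. -/
def infinitesimalGenerator (η : GroupLieAlgebra J G) (q : Q) : TangentSpace I q :=
  (mfderiv 𝓘(ℝ, ℝ) I (fun t : ℝ ↦ lieExp (t • η) • q) 0 (1 : ℝ) : E)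

/-- The momentum map component `J_η = ⟨p, Y_η⟩` of the lifted action. -/
def momentumMap {I : ModelWithCorners ℝ E H} (L : TangentBundle I Q → ℝ)
    (η : GroupLieAlgebra J G) (v : TangentBundle I Q) : ℝ :=
  momentum L v (infinitesimalGenerator I η v.proj)

end Action

end MovingEnergy

end

/-!
Let `Φ` be the flow of `Y` and let `L` be `Φ`-invariant. Differentiating the invariance at time `0`
shows that the complete lift `(Y, DY · v)` of `Y` to `TQ` annihilates `dL`. Hence, along a
second-order tangent vector at `v`, the derivative of `E_L - ⟨p, Y⟩ = ⟨p, v - Y⟩ - L` is the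
left-hand side of Lagrange equations paired with `v - Y`. On `M₀` both `v - ξ` and `Y - ξ` lie in
the constraint distribution `D`, hence so does `v - Y`, and the reaction force, which annihilates
`D`, does not change `E_L - ⟨p, Y⟩`.

As to the moving energy, on each fibre the lift `DC` is the affine map `w ↦ TΦ_t w + Y`, so that
`E_{L ∘ DC}` at `DC⁻¹(v)` is the derivative of `L` at `v` applied to the linear part `v - Y`,
minus `L(v)`.
-/

namespace MovingEnergy

section Curves

variable {E : Type*} [NormedAddCommGroup E] [NormedSpace ℝ E]
  {H : Type*} [TopologicalSpace H] {I : ModelWithCorners ℝ E H}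
  {M : Type*} [TopologicalSpace M] [ChartedSpace H M]
  {E' : Type*} [NormedAddCommGroup E'] [NormedSpace ℝ E']
  {H' : Type*} [TopologicalSpace H'] {I' : ModelWithCorners ℝ E' H'}
  {N : Type*} [TopologicalSpace N] [ChartedSpace H' N]
  {E'' : Type*} [NormedAddCommGroup E''] [NormedSpace ℝ E'']
  {H'' : Type*} [TopologicalSpace H''] {I'' : ModelWithCorners ℝ E'' H''}
  {P : Type*} [TopologicalSpace P] [ChartedSpace H'' P]

theorem tangentBundle_mk_congr {x y : M} (h : x = y) (u : E) :
    (⟨x, u⟩ : TangentBundle I M) = ⟨y, u⟩ := by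
  subst h
  rfl

theorem hasMFDerivWithinAt_comp_curve {f : M → N} {γ : ℝ → M} {s : Set ℝ} {t : ℝ}
    {a : TangentSpace I (γ t)} {A : TangentSpace I (γ t) →L[ℝ] TangentSpace I' (f (γ t))}
    (hf : HasMFDerivAt I I' f (γ t) A)
    (hγ : HasMFDerivWithinAt 𝓘(ℝ, ℝ) I γ s t ((1 : ℝ →L[ℝ] ℝ).smulRight a)) :
    HasMFDerivWithinAt 𝓘(ℝ, ℝ) I' (fun t ↦ f (γ t)) s t ((1 : ℝ →L[ℝ] ℝ).smulRight (A a)) :=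
  (hf.comp_hasMFDerivWithinAt t hγ).congr_mfderiv
    (ContinuousLinearMap.ext fun r : ℝ ↦ (A : E →L[ℝ] E').map_smul r a)

theorem hasDerivWithinAt_comp_curve {F : Type*} [NormedAddCommGroup F] [NormedSpace ℝ F]
    {f : M → F} {γ : ℝ → M} {s : Set ℝ} {t : ℝ} {a : TangentSpace I (γ t)}
    (hf : MDifferentiableAt I 𝓘(ℝ, F) f (γ t))
    (hγ : HasMFDerivWithinAt 𝓘(ℝ, ℝ) I γ s t ((1 : ℝ →L[ℝ] ℝ).smulRight a)) :
    HasDerivWithinAt (fun t ↦ f (γ t)) (mfderiv I 𝓘(ℝ, F) f (γ t) a : F) s t := by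
  let d : F := mfderiv I 𝓘(ℝ, F) f (γ t) a
  have hcomp : HasFDerivWithinAt (fun t ↦ f (γ t)) ((1 : ℝ →L[ℝ] ℝ).smulRight d) s t :=
    (hasMFDerivWithinAt_comp_curve hf.hasMFDerivAt hγ).hasFDerivWithinAt
  exact hcomp.hasDerivWithinAt.congr_deriv (one_smul ℝ d)

theorem contMDiff_tangentMap_snd [IsManifold I ∞ M] [IsManifold I' ∞ N] [IsManifold I'' ∞ P]
    {Φ : M → N → P} (hΦ : ContMDiff (I.prod I') I'' ∞ fun p : M × N ↦ Φ p.1 p.2) :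
    ContMDiff (I.prod I'.tangent) I''.tangent ∞
      fun p : M × TangentBundle I' N ↦ tangentMap I' I'' (Φ p.1) p.2 := by
  have hzero : ContMDiff I I.tangent ∞ fun m : M ↦ (⟨m, 0⟩ : TangentBundle I M) :=
    Bundle.contMDiff_zeroSection _ _
  have hcomp := (hΦ.contMDiff_tangentMap (m := ∞) (by simp)).comp
    ((contMDiff_equivTangentBundleProd_symm (I := I) (I' := I') (M := M) (M' := N)).comp
      ((hzero.comp contMDiff_fst).prodMk contMDiff_snd))
  refine hcomp.congr fun p ↦ ?_
  have hΦp : MDifferentiableAt (I.prod I') I'' (fun p : M × N ↦ Φ p.1 p.2) (p.1, p.2.proj) :=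
    hΦ.mdifferentiableAt (by simp)
  have hpair : MDifferentiableAt I' (I.prod I') (fun n ↦ (p.1, n)) p.2.proj :=
    mdifferentiableAt_const.prodMk mdifferentiableAt_id
  exact (tangentMap_comp_at p.2 hΦp hpair).trans (congrArg _ tangentMap_prod_right)

theorem contMDiff_of_isMIntegralCurve [I.Boundaryless] [IsManifold I ∞ M]
    {v : ∀ x : M, TangentSpace I x} {γ : ℝ → M}
    (hv : ContMDiff I I.tangent ∞ fun x ↦ (⟨x, v x⟩ : TangentBundle I M))
    (hγ : IsMIntegralCurve γ v) : ContMDiff 𝓘(ℝ, ℝ) I ∞ γ := by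
  -- `γ' = v ∘ γ` has the regularity of `γ`, so that `γ` has one more derivative than assumed.
  suffices hfinite : ∀ n : ℕ, ContMDiff 𝓘(ℝ, ℝ) I n γ from contMDiff_infty.2 hfinite
  intro n
  induction n with
  | zero => exact contMDiff_zero_iff.2 hγ.continuous
  | succ n ih =>
    intro t₀
    have hvelocity := (Bundle.contMDiffAt_totalSpace.1
      (((hv.of_le (by exact_mod_cast le_top)).comp ih) t₀)).2
    rw [contMDiffAt_iff_contDiffAt] at hvelocity
    refine contMDiffAt_iff_target.2 ⟨hγ.continuous.continuousAt, contMDiffAt_iff_contDiffAt.2 ?_⟩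
    refine (contDiffAt_succ_iff_hasFDerivAt (n := n)).2 ⟨_, ⟨_,
      (hγ.isMIntegralCurveAt t₀).eventually_hasDerivAt, fun t ht ↦ ht.hasFDerivAt⟩, ?_⟩
    exact (ContinuousLinearMap.smulRightL ℝ ℝ E (1 : ℝ →L[ℝ] ℝ)).contDiff.contDiffAt.comp t₀
      hvelocity

theorem eq_of_isMIntegralCurveOn_of_mfderiv_eq_zero {v : ∀ x : M, TangentSpace I x} {f : M → ℝ}
    {γ : ℝ → M} {s : Set ℝ} (hs : s.OrdConnected) (hγ : IsMIntegralCurveOn γ v s)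
    (hf : ∀ t ∈ s, MDifferentiableAt I 𝓘(ℝ, ℝ) f (γ t))
    (hzero : ∀ t ∈ s, (mfderiv I 𝓘(ℝ, ℝ) f (γ t) (v (γ t)) : ℝ) = 0)
    {t₁ t₂ : ℝ} (ht₁ : t₁ ∈ s) (ht₂ : t₂ ∈ s) : f (γ t₁) = f (γ t₂) := by
  have hderiv : ∀ t ∈ s, HasDerivWithinAt (fun t ↦ f (γ t)) 0 s t := fun t ht ↦
    (hasDerivWithinAt_comp_curve (hf t ht) (hγ t ht)).congr_deriv (hzero t ht)
  have hle := hs.convex.norm_image_sub_le_of_norm_hasDerivWithin_le (C := 0) hderiv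
    (fun _ _ ↦ norm_zero.le) ht₂ ht₁
  rwa [zero_mul, norm_le_zero_iff, sub_eq_zero] at hle

end Curves

section Flow

variable {E : Type*} [NormedAddCommGroup E] [NormedSpace ℝ E]
  {H : Type*} [TopologicalSpace H] {I : ModelWithCorners ℝ E H}
  {Q : Type*} [TopologicalSpace Q] [ChartedSpace H Q]
  {Φ : Q → ℝ → Q} {Y : ∀ q : Q, TangentSpace I q}

theorem IsFlow.mfderiv_apply_one (hflow : IsFlow Φ Y) (q : Q) (t : ℝ) :
    (mfderiv 𝓘(ℝ, ℝ) I (Φ q) t (1 : ℝ) : E) = Y (Φ q t) := by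
  rw [((hflow q).2 t).mfderiv]
  exact one_smul ℝ (Y (Φ q t) : E)

theorem isFlow_of_add (hzero : ∀ q, Φ q 0 = q) (hadd : ∀ q s t, Φ q (s + t) = Φ (Φ q s) t)
    (hderiv : ∀ q, HasMFDerivAt 𝓘(ℝ, ℝ) I (Φ q) 0 ((1 : ℝ →L[ℝ] ℝ).smulRight (Y (Φ q 0)))) :
    IsFlow Φ Y := by
  refine fun q ↦ ⟨hzero q, fun t ↦ ?_⟩
  have htranslate : Φ (Φ q t) ∘ (fun s ↦ s - t) = Φ q := by
    funext s
    rw [Function.comp_apply, ← hadd, add_sub_cancel]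
  have hsub : HasMFDerivAt 𝓘(ℝ, ℝ) 𝓘(ℝ, ℝ) (fun s : ℝ ↦ s - t) t (ContinuousLinearMap.id ℝ ℝ) :=
    ((hasFDerivAt_id t).sub_const t).hasMFDerivAt
  have hderivt := hderiv (Φ q t)
  rw [← sub_self t] at hderivt
  have hcomp := HasMFDerivAt.comp (f := fun s ↦ s - t) t hderivt hsub
  rw [htranslate, sub_self, hzero] at hcomp
  exact hcomp

theorem IsFlow.contMDiff_vectorField [IsManifold I ∞ Q] (hflow : IsFlow Φ Y)
    (hΦ : ContMDiff (I.prod 𝓘(ℝ, ℝ)) I ∞ fun p : Q × ℝ ↦ Φ p.1 p.2) :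
    ContMDiff I I.tangent ∞ fun q ↦ (⟨q, Y q⟩ : TangentBundle I Q) := by
  have hvelocity := (contMDiff_tangentMap_snd hΦ).comp
    (contMDiff_id.prodMk (contMDiff_const (c := (⟨0, (1 : ℝ)⟩ : TangentBundle 𝓘(ℝ, ℝ) ℝ))))
  refine hvelocity.congr fun q ↦ ?_
  calc (⟨q, Y q⟩ : TangentBundle I Q) = ⟨Φ q 0, Y (Φ q 0)⟩ := by rw [(hflow q).1]
    _ = tangentMap 𝓘(ℝ, ℝ) I (Φ q) ⟨0, (1 : ℝ)⟩ :=
      congrArg (fun y : E ↦ (⟨Φ q 0, y⟩ : TangentBundle I Q)) (hflow.mfderiv_apply_one q 0).symm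

theorem IsFlow.unique [IsManifold I 1 Q] [I.Boundaryless] [T2Space Q]
    (hY : ContMDiff I I.tangent 1 fun q ↦ (⟨q, Y q⟩ : TangentBundle I Q))
    {Φ' : Q → ℝ → Q} (hflow : IsFlow Φ Y) (hflow' : IsFlow Φ' Y) : Φ = Φ' :=
  funext fun q ↦ isMIntegralCurve_Ioo_eq_of_contMDiff_boundaryless (t₀ := 0) hY
    (hflow q).2 (hflow' q).2 ((hflow q).1.trans (hflow' q).1.symm)

theorem IsFlow.add [IsManifold I 1 Q] [I.Boundaryless] [T2Space Q]
    (hY : ContMDiff I I.tangent 1 fun q ↦ (⟨q, Y q⟩ : TangentBundle I Q))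
    (hflow : IsFlow Φ Y) (q : Q) (s t : ℝ) : Φ q (s + t) = Φ (Φ q s) t := by
  have htranslate := isMIntegralCurve_Ioo_eq_of_contMDiff_boundaryless (t₀ := 0) hY
    ((hflow q).2.comp_add s) (hflow (Φ q s)).2
    ((congrArg (Φ q) (zero_add s)).trans (hflow (Φ q s)).1.symm)
  exact (congrArg (Φ q) (add_comm s t)).trans (congrFun htranslate t)

variable [IsManifold I ∞ Q] [I.Boundaryless] [T2Space Q]

/-- A global smooth flow `Φ`, as a time-dependent diffeomorphism: its inverse at time `t` is
`Φ` at time `-t`. -/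
noncomputable def IsFlow.toTimeDependentDiffeo (hflow : IsFlow Φ Y)
    (hΦ : ContMDiff (I.prod 𝓘(ℝ, ℝ)) I ∞ fun p : Q × ℝ ↦ Φ p.1 p.2) :
    TimeDependentDiffeo I I Q Q :=
  have hadd := hflow.add ((hflow.contMDiff_vectorField hΦ).of_le (by exact_mod_cast le_top))
  { toDiffeo :=
      { toFun := fun p ↦ (Φ p.1 p.2, p.2)
        invFun := fun p ↦ (Φ p.1 (-p.2), p.2)
        left_inv := fun p ↦ Prod.ext (by
          change Φ (Φ p.1 p.2) (-p.2) = p.1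
          rw [← hadd, add_neg_cancel, (hflow p.1).1]) rfl
        right_inv := fun p ↦ Prod.ext (by
          change Φ (Φ p.1 (-p.2)) p.2 = p.1
          rw [← hadd, neg_add_cancel, (hflow p.1).1]) rfl
        contMDiff_toFun := hΦ.prodMk contMDiff_snd
        contMDiff_invFun := (hΦ.comp (contMDiff_fst.prodMk
          (contDiff_neg.contMDiff.comp contMDiff_snd))).prodMk contMDiff_snd }
    time_eq := fun _ ↦ rfl }

theorem IsFlow.existsUnique_timeDependentDiffeo (hflow : IsFlow Φ Y)
    (hΦ : ContMDiff (I.prod 𝓘(ℝ, ℝ)) I ∞ fun p : Q × ℝ ↦ Φ p.1 p.2) :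
    ∃! C : TimeDependentDiffeo I I Q Q, IsFlow C.map Y := by
  refine ⟨hflow.toTimeDependentDiffeo hΦ, hflow, fun C hC ↦
    TimeDependentDiffeo.ext (Diffeomorph.ext fun p ↦ Prod.ext ?_ (C.time_eq p))⟩
  exact congrFun₂ (hC.unique
    ((hflow.contMDiff_vectorField hΦ).of_le (by exact_mod_cast le_top)) hflow) p.1 p.2

end Flow

section OneParameterSubgroup

variable {F : Type*} [NormedAddCommGroup F] [NormedSpace ℝ F]
  {K : Type*} [TopologicalSpace K] {J : ModelWithCorners ℝ F K}
  {G : Type*} [TopologicalSpace G] [ChartedSpace K G] [Group G]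

theorem contMDiff_infty_mulInvariantVectorField [ContMDiffMul J ∞ G] (η : GroupLieAlgebra J G) :
    ContMDiff J J.tangent ∞
      fun g : G ↦ (⟨g, mulInvariantVectorField η g⟩ : TangentBundle J G) := by
  have : IsManifold J ∞ G := ContMDiffMul.toIsManifold
  have htranslate := (contMDiff_tangentMap_snd (Φ := fun g h : G ↦ g * h) (contMDiff_mul J ∞)).comp
    (contMDiff_id.prodMk (contMDiff_const (c := (⟨1, η⟩ : TangentBundle J G))))
  exact htranslate.congr fun g ↦ tangentBundle_mk_congr (mul_one g).symm _

theorem mfderiv_mul_left_mulInvariantVectorField [ContMDiffMul J ∞ G] (η : GroupLieAlgebra J G)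
    (g h : G) :
    (mfderiv J J (g * ·) h (mulInvariantVectorField η h) : F) =
      mulInvariantVectorField η (g * h) := by
  have hmul : ∀ a x : G, MDifferentiableAt J J (a * ·) x := fun a x ↦
    (contMDiff_mul_left (I := J) (n := ∞)).mdifferentiableAt (by simp)
  have hcomp := congrArg (fun w : TangentBundle J G ↦ (w.snd : F))
    (tangentMap_comp_at (⟨1, η⟩ : TangentBundle J G) (hmul g (h * 1)) (hmul h 1))
  have hassoc : (g * ·) ∘ (h * ·) = (g * h * ·) := funext fun x ↦ (mul_assoc g h x).symm
  rw [hassoc] at hcomp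
  refine Eq.trans ?_ hcomp.symm
  change (mfderiv J J (g * ·) h : F →L[ℝ] F) _ = (mfderiv J J (g * ·) (h * 1) : F →L[ℝ] F) _
  rw [mul_one]
  rfl

theorem isMIntegralCurveOn_mul_left [ContMDiffMul J ∞ G] {η : GroupLieAlgebra J G} {γ : ℝ → G}
    {s : Set ℝ} (g : G) (hγ : IsMIntegralCurveOn γ (mulInvariantVectorField η) s) :
    IsMIntegralCurveOn (fun t ↦ g * γ t) (mulInvariantVectorField η) s := by
  intro t ht
  have hmul : MDifferentiableAt J J (g * ·) (γ t) :=
    (contMDiff_mul_left (I := J) (n := ∞)).mdifferentiableAt (by simp)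
  rw [← mfderiv_mul_left_mulInvariantVectorField]
  exact hasMFDerivWithinAt_comp_curve hmul.hasMFDerivAt (hγ t ht)

variable [ContMDiffMul J ∞ G] [J.Boundaryless] [T2Space G]

theorem isMIntegralCurve_mulInvariantVectorField_ext {η : GroupLieAlgebra J G} {γ γ' : ℝ → G}
    (hγ : IsMIntegralCurve γ (mulInvariantVectorField η))
    (hγ' : IsMIntegralCurve γ' (mulInvariantVectorField η)) (hzero : γ 0 = γ' 0) : γ = γ' :=
  have : IsManifold J ∞ G := ContMDiffMul.toIsManifold
  isMIntegralCurve_Ioo_eq_of_contMDiff_boundaryless (t₀ := 0)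
    ((contMDiff_infty_mulInvariantVectorField η).of_le (by exact_mod_cast le_top)) hγ hγ' hzero

theorem lieExp_smul_eq_of_isMIntegralCurve {η : GroupLieAlgebra J G} {γ : ℝ → G} (hone : γ 0 = 1)
    (hγ : IsMIntegralCurve γ (mulInvariantVectorField η)) (t : ℝ) : lieExp (t • η) = γ t := by
  have hscaled : IsMIntegralCurve (fun s ↦ γ (s * t)) (mulInvariantVectorField (t • η)) := by
    rw [mulInvariantVectorField_smul]
    exact hγ.comp_mul t
  have hscaled_zero : γ (0 * t) = 1 := by rw [zero_mul, hone]
  have hexists : ∃ γ : ℝ → G, γ 0 = 1 ∧ IsMIntegralCurve γ (mulInvariantVectorField (t • η)) :=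
    ⟨_, hscaled_zero, hscaled⟩
  have heq := isMIntegralCurve_mulInvariantVectorField_ext hexists.choose_spec.2 hscaled
    (hexists.choose_spec.1.trans hscaled_zero.symm)
  rw [lieExp, dif_pos hexists, heq]
  exact congrArg γ (one_mul t)

variable [CompleteSpace F]

theorem exists_isMIntegralCurve_mulInvariantVectorField (η : GroupLieAlgebra J G) :
    ∃ γ : ℝ → G, γ 0 = 1 ∧ IsMIntegralCurve γ (mulInvariantVectorField η) := by
  have : IsManifold J ∞ G := ContMDiffMul.toIsManifold
  have hsmooth : ContMDiff J J.tangent 1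
      fun g : G ↦ (⟨g, mulInvariantVectorField η g⟩ : TangentBundle J G) :=
    (contMDiff_infty_mulInvariantVectorField η).of_le (by exact_mod_cast le_top)
  obtain ⟨γ, hone, hγ⟩ := exists_isMIntegralCurveAt_of_contMDiffAt_boundaryless 0
    (hsmooth.contMDiffAt (x := 1))
  obtain ⟨ε, hε, hγ⟩ := isMIntegralCurveAt_iff'.1 hγ
  rw [Real.ball_eq_Ioo, zero_sub, zero_add] at hγ
  -- Left translates of `γ` are integral curves, so a single `ε` serves every initial point.
  exact exists_isMIntegralCurve_of_isMIntegralCurveOn hsmooth hε (fun g ↦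
    ⟨fun t ↦ g * γ t, (congrArg (g * ·) hone).trans (mul_one g),
      isMIntegralCurveOn_mul_left g hγ⟩) 1

theorem isMIntegralCurve_lieExp_smul (η : GroupLieAlgebra J G) :
    IsMIntegralCurve (fun t : ℝ ↦ (lieExp (t • η) : G)) (mulInvariantVectorField η) := by
  obtain ⟨γ, hone, hγ⟩ := exists_isMIntegralCurve_mulInvariantVectorField η
  rwa [funext (lieExp_smul_eq_of_isMIntegralCurve hone hγ)]

theorem lieExp_zero : (lieExp (0 : GroupLieAlgebra J G) : G) = 1 := by
  obtain ⟨γ, hone, hγ⟩ := exists_isMIntegralCurve_mulInvariantVectorField (0 : GroupLieAlgebra J G)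
  exact (congrArg lieExp (zero_smul ℝ 0)).symm.trans
    ((lieExp_smul_eq_of_isMIntegralCurve hone hγ 0).trans hone)

theorem lieExp_add_smul (η : GroupLieAlgebra J G) (s t : ℝ) :
    (lieExp ((s + t) • η) : G) = lieExp (s • η) * lieExp (t • η) := by
  have hexp := isMIntegralCurve_lieExp_smul η
  have htranslate : IsMIntegralCurve (fun t ↦ (lieExp (s • η) : G) * lieExp (t • η))
      (mulInvariantVectorField η) :=
    isMIntegralCurve_iff_isMIntegralCurveOn.2
      (isMIntegralCurveOn_mul_left _ (hexp.isMIntegralCurveOn Set.univ))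
  have heq := isMIntegralCurve_mulInvariantVectorField_ext (hexp.comp_add s) htranslate
    (by simp [lieExp_zero])
  simpa only [Function.comp_apply, add_comm] using congrFun heq t

theorem contMDiff_lieExp_smul (η : GroupLieAlgebra J G) :
    ContMDiff 𝓘(ℝ, ℝ) J ∞ fun t : ℝ ↦ (lieExp (t • η) : G) :=
  have : IsManifold J ∞ G := ContMDiffMul.toIsManifold
  contMDiff_of_isMIntegralCurve (contMDiff_infty_mulInvariantVectorField η)
    (isMIntegralCurve_lieExp_smul η)

variable {E : Type*} [NormedAddCommGroup E] [NormedSpace ℝ E]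
  {H : Type*} [TopologicalSpace H] (I : ModelWithCorners ℝ E H)
  {Q : Type*} [TopologicalSpace Q] [ChartedSpace H Q]
  [MulAction G Q] [ContMDiffSMul J I ∞ G Q]

theorem contMDiff_lieExp_smul_smul (η : GroupLieAlgebra J G) :
    ContMDiff (I.prod 𝓘(ℝ, ℝ)) I ∞ fun p : Q × ℝ ↦ (lieExp (p.2 • η) : G) • p.1 :=
  (contMDiff_smul (I := J) (I' := I) (n := ∞) (G := G) (M := Q)).comp
    (((contMDiff_lieExp_smul η).comp contMDiff_snd).prodMk contMDiff_fst)

theorem isFlow_lieExp_smul_smul (η : GroupLieAlgebra J G) :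
    IsFlow (fun (q : Q) (t : ℝ) ↦ (lieExp (t • η) : G) • q) (infinitesimalGenerator I η) := by
  have hzero : ∀ q : Q, (lieExp ((0 : ℝ) • η) : G) • q = q := fun q ↦ by
    rw [zero_smul, lieExp_zero, one_smul]
  have hadd : ∀ (q : Q) (s t : ℝ), (lieExp ((s + t) • η) : G) • q =
      (lieExp (t • η) : G) • (lieExp (s • η) : G) • q := fun q s t ↦ by
    rw [add_comm, lieExp_add_smul, mul_smul]
  refine isFlow_of_add hzero hadd fun q ↦ ?_
  have horbit : MDifferentiableAt 𝓘(ℝ, ℝ) I (fun t : ℝ ↦ (lieExp (t • η) : G) • q) 0 :=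
    ((contMDiff_lieExp_smul_smul I η).comp
      (contMDiff_const.prodMk contMDiff_id)).mdifferentiableAt (by simp)
  have hvelocity : (mfderiv 𝓘(ℝ, ℝ) I (fun t : ℝ ↦ (lieExp (t • η) : G) • q) 0 (1 : ℝ) : E) =
      infinitesimalGenerator I η ((lieExp ((0 : ℝ) • η) : G) • q) := by
    rw [hzero]
    rfl
  exact horbit.hasMFDerivAt.congr_mfderiv
    (ContinuousLinearMap.ext_ring (hvelocity.trans (one_smul ℝ (_ : E)).symm))

end OneParameterSubgroup

section Fibre

variable {E : Type*} [NormedAddCommGroup E] [NormedSpace ℝ E]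
  {H : Type*} [TopologicalSpace H] {I : ModelWithCorners ℝ E H}
  {Q : Type*} [TopologicalSpace Q] [ChartedSpace H Q]

theorem lift_eq_of_isFlow {Y : ∀ q : Q, TangentSpace I q} {C : TimeDependentDiffeo I I Q Q}
    (hC : IsFlow C.map Y) (q : Q) (t : ℝ) (w : E) :
    C.lift (⟨q, w⟩, t) =
      (⟨C.map q t, mfderiv I I (fun u ↦ C.map u t) q w + Y (C.map q t)⟩, t) :=
  congrArg (fun y : TangentSpace I (C.map q t) ↦ ((⟨C.map q t,
    mfderiv I I (fun u ↦ C.map u t) q w + y⟩, t) : TangentBundle I Q × ℝ))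
    (hC.mfderiv_apply_one q t)

variable [IsManifold I ∞ Q]

theorem contMDiff_tangentBundle_mk (q : Q) :
    ContMDiff 𝓘(ℝ, E) I.tangent ∞ fun w : E ↦ (⟨q, w⟩ : TangentBundle I Q) := fun _ ↦
  Bundle.contMDiffAt_totalSpace.2
    ⟨contMDiffAt_const, (tangentCoordChange I q q q).contMDiff.contMDiffAt⟩

theorem differentiable_fibre {L : TangentBundle I Q → ℝ}
    (hL : ContMDiff I.tangent 𝓘(ℝ, ℝ) ∞ L) (q : Q) :
    Differentiable ℝ fun w : E ↦ L ⟨q, w⟩ :=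
  (contMDiff_iff_contDiff.1 (hL.comp (contMDiff_tangentBundle_mk q))).differentiable (by simp)

theorem extendedEnergy_comp_lift {L : TangentBundle I Q → ℝ}
    (hL : ContMDiff I.tangent 𝓘(ℝ, ℝ) ∞ L) {Y : ∀ q : Q, TangentSpace I q}
    {C : TimeDependentDiffeo I I Q Q} (hC : IsFlow C.map Y) (z : TangentBundle I Q × ℝ) :
    extendedEnergy ((fun z ↦ L z.1) ∘ C.lift) z =
      energy L (C.lift z).1 - momentum L (C.lift z).1 (Y (C.lift z).1.proj) := by
  obtain ⟨⟨q, w⟩, t⟩ := z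
  change E at w
  let A : E →L[ℝ] E := mfderiv I I (fun u ↦ C.map u t) q
  let b : E := Y (C.map q t)
  let ℓ : E → ℝ := fun y ↦ L ⟨C.map q t, y⟩
  have hfibre : (fun u : E ↦ L (C.lift (⟨q, u⟩, t)).1) = fun u ↦ ℓ (A u + b) :=
    funext fun u ↦ congrArg (fun z : TangentBundle I Q × ℝ ↦ L z.1) (lift_eq_of_isFlow hC q t u)
  have hchain : fderiv ℝ (fun u ↦ ℓ (A u + b)) w = (fderiv ℝ ℓ (A w + b)).comp A :=
    ((differentiable_fibre hL _ _).hasFDerivAt.comp w (A.hasFDerivAt.add_const b)).fderiv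
  rw [lift_eq_of_isFlow hC q t w]
  calc extendedEnergy ((fun z ↦ L z.1) ∘ C.lift) ((⟨q, w⟩ : TangentBundle I Q), t)
      = fderiv ℝ (fun u : E ↦ L (C.lift (⟨q, u⟩, t)).1) w w - L (C.lift (⟨q, w⟩, t)).1 := rfl
    _ = fderiv ℝ ℓ (A w + b) (A w) - ℓ (A w + b) := by
      rw [hfibre, hchain, congrFun hfibre w, ContinuousLinearMap.comp_apply]
    _ = fderiv ℝ ℓ (A w + b) (A w + b) - ℓ (A w + b) - fderiv ℝ ℓ (A w + b) b := by
      rw [map_add]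
      ring

theorem movingEnergy_eq {L : TangentBundle I Q → ℝ}
    (hL : ContMDiff I.tangent 𝓘(ℝ, ℝ) ∞ L) {Y : ∀ q : Q, TangentSpace I q}
    {C : TimeDependentDiffeo I I Q Q} (hC : IsFlow C.map Y) (v : TangentBundle I Q) (t : ℝ) :
    movingEnergy (fun z ↦ L z.1) C (v, t) = energy L v - momentum L v (Y v.proj) := by
  have hlift : C.lift (C.liftEquiv.symm (v, t)) = (v, t) := C.liftEquiv.apply_symm_apply (v, t)
  have henergy := extendedEnergy_comp_lift hL hC (C.liftEquiv.symm (v, t))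
  rwa [hlift] at henergy

end Fibre

section Calculus

variable {E : Type*} [NormedAddCommGroup E] [NormedSpace ℝ E]
  {E' : Type*} [NormedAddCommGroup E'] [NormedSpace ℝ E']

theorem hasDerivAt_comp_prodMk_right {φ : ℝ × E → E'} {s : ℝ} {x : E}
    (hφ : DifferentiableAt ℝ φ (s, x)) :
    HasDerivAt (fun r ↦ φ (r, x)) (fderiv ℝ φ (s, x) (1, 0)) s :=
  HasFDerivAt.comp_hasDerivAt (l := φ) s hφ.hasFDerivAt
    ((hasDerivAt_id s).prodMk (hasDerivAt_const s x))

theorem hasDerivAt_tangentLift {φ : ℝ × E → E'} {s : ℝ} {x : E}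
    (hφ : ContDiffAt ℝ 2 φ (s, x)) (y : E) :
    HasDerivAt (fun r ↦ (φ (r, x), fderiv ℝ φ (r, x) (0, y)))
      (fderiv ℝ φ (s, x) (1, 0), fderiv ℝ (fun x' ↦ fderiv ℝ φ (s, x') (1, 0)) x y) s := by
  have hfderiv : DifferentiableAt ℝ (fderiv ℝ φ) (s, x) :=
    (hφ.fderiv_right (m := 1) (by norm_num)).differentiableAt (by norm_num)
  have hsymm : fderiv ℝ (fderiv ℝ φ) (s, x) (1, 0) (0, y) =
      fderiv ℝ (fderiv ℝ φ) (s, x) (0, y) (1, 0) :=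
    (hφ.isSymmSndFDerivAt (by simp)).eq _ _
  have hvelocity : HasFDerivAt (fun x' ↦ fderiv ℝ φ (s, x') (1, 0))
      ((ContinuousLinearMap.apply ℝ E' ((1, 0) : ℝ × E)).comp
        ((fderiv ℝ (fderiv ℝ φ) (s, x)).comp (ContinuousLinearMap.inr ℝ ℝ E))) x :=
    (ContinuousLinearMap.apply ℝ E' ((1, 0) : ℝ × E)).hasFDerivAt.comp x
      (hfderiv.hasFDerivAt.comp x (hasFDerivAt_prodMk_right s x))
  have hspace : HasDerivAt (fun r ↦ fderiv ℝ φ (r, x) (0, y))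
      (fderiv ℝ (fderiv ℝ φ) (s, x) (1, 0) (0, y)) s :=
    (ContinuousLinearMap.apply ℝ E' ((0, y) : ℝ × E)).hasFDerivAt.comp_hasDerivAt s
      (hasDerivAt_comp_prodMk_right hfderiv)
  rw [hsymm] at hspace
  rw [hvelocity.fderiv]
  exact (hasDerivAt_comp_prodMk_right (hφ.differentiableAt (by norm_num))).prodMk hspace

/-- The moving energy `∂ℓ/∂ẋ (ẋ - Y) - ℓ` of a Lagrangian `ℓ (x, ẋ)` on a vector space, relative to
a vector field `Y`. -/
noncomputable def localMovingEnergy (ℓ : E × E → ℝ) (Y : E → E) (z : E × E) : ℝ :=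
  fderiv ℝ ℓ z (0, z.2 - Y z.1) - ℓ z

/-- The left-hand side `d/dt ∂ℓ/∂ẋ - ∂ℓ/∂x` of Lagrange equations on a vector space, at the point
`z = (x, ẋ)` and with `d/dt` the derivative along `dz`. It agrees with the covector inside
`lagrangeCovector`. -/
noncomputable def eulerLagrange (ℓ : E × E → ℝ) (z dz : E × E) : E →L[ℝ] ℝ :=
  fderiv ℝ (fun w ↦ (fderiv ℝ ℓ w).comp (ContinuousLinearMap.inr ℝ E E)) z dz -
    (fderiv ℝ ℓ z).comp (ContinuousLinearMap.inl ℝ E E)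

theorem fderiv_localMovingEnergy {ℓ : E × E → ℝ} {Y : E → E} {x y : E}
    (hℓ : ContDiffAt ℝ 2 ℓ (x, y)) (hY : DifferentiableAt ℝ Y x) (a : E) :
    fderiv ℝ (localMovingEnergy ℓ Y) (x, y) (y, a) =
      eulerLagrange ℓ (x, y) (y, a) (y - Y x) - fderiv ℝ ℓ (x, y) (Y x, fderiv ℝ Y x y) := by
  let p : E × E → E →L[ℝ] ℝ := fun w ↦ (fderiv ℝ ℓ w).comp (ContinuousLinearMap.inr ℝ E E)
  have hp : HasFDerivAt p (fderiv ℝ p (x, y)) (x, y) :=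
    (((hℓ.fderiv_right (m := 1) (by norm_num)).differentiableAt (by norm_num)).clm_comp
      (differentiableAt_const _)).hasFDerivAt
  have hrelative : HasFDerivAt (fun w : E × E ↦ w.2 - Y w.1)
      (ContinuousLinearMap.snd ℝ E E - (fderiv ℝ Y x).comp (ContinuousLinearMap.fst ℝ E E))
      (x, y) :=
    hasFDerivAt_snd.sub (hY.hasFDerivAt.comp (x, y) hasFDerivAt_fst)
  have henergy : fderiv ℝ (localMovingEnergy ℓ Y) (x, y) (y, a) =
      p (x, y) (a - fderiv ℝ Y x y) + fderiv ℝ p (x, y) (y, a) (y - Y x) -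
        fderiv ℝ ℓ (x, y) (y, a) :=
    DFunLike.congr_fun ((hp.clm_apply hrelative).sub
      (hℓ.differentiableAt (by norm_num)).hasFDerivAt).fderiv (y, a)
  have hsplit : ∀ u w : E, fderiv ℝ ℓ (x, y) (u, w) = fderiv ℝ ℓ (x, y) (u, 0) + p (x, y) w :=
    fun u w ↦ (fderiv ℝ ℓ (x, y)).comp_inl_add_comp_inr (u, w) |>.symm
  have hlagrange : eulerLagrange ℓ (x, y) (y, a) (y - Y x) =
      fderiv ℝ p (x, y) (y, a) (y - Y x) -
        (fderiv ℝ ℓ (x, y) (y, 0) - fderiv ℝ ℓ (x, y) (Y x, 0)) := by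
    rw [← map_sub, Prod.mk_sub_mk, sub_zero]
    rfl
  rw [henergy, hlagrange, hsplit y a, hsplit (Y x) (fderiv ℝ Y x y), map_sub]
  ring

end Calculus

section Coordinates

variable {E : Type*} [NormedAddCommGroup E] [NormedSpace ℝ E]
  {H : Type*} [TopologicalSpace H] {I : ModelWithCorners ℝ E H}
  {Q : Type*} [TopologicalSpace Q] [ChartedSpace H Q]

/-- The local representative of a vector field `Y` in the chart around `q`. -/
noncomputable def coordField (Y : ∀ q : Q, TangentSpace I q) (q : Q) (x : E) : E :=
  mfderiv I 𝓘(ℝ, E) (extChartAt I q) ((extChartAt I q).symm x) (Y ((extChartAt I q).symm x))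

theorem coordField_extChartAt (Y : ∀ q : Q, TangentSpace I q) {q x : Q}
    (hx : x ∈ (extChartAt I q).source) :
    coordField Y q (extChartAt I q x) = mfderiv I 𝓘(ℝ, E) (extChartAt I q) x (Y x) := by
  rw [coordField, (extChartAt I q).left_inv hx]

variable [IsManifold I ∞ Q]

theorem mdifferentiableAt_extChartAt_of_mem {q x : Q} (hx : x ∈ (extChartAt I q).source) :
    MDifferentiableAt I 𝓘(ℝ, E) (extChartAt I q) x :=
  mdifferentiableAt_extChartAt (by rwa [← extChartAt_source I])

theorem mfderiv_extChartAt_eq_tangentCoordChange {q x : Q} (hx : x ∈ (extChartAt I q).source) :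
    mfderiv I 𝓘(ℝ, E) (extChartAt I q) x = tangentCoordChange I x q x := by
  rw [extChartAt_source] at hx
  rw [(hasMFDerivAt_extChartAt hx).mfderiv]
  exact mfderiv_chartAt_eq_tangentCoordChange hx

theorem mem_extChartAt_tangent_source {v w : TangentBundle I Q} :
    w ∈ (extChartAt I.tangent v).source ↔ w.proj ∈ (extChartAt I v.proj).source := by
  rw [extChartAt_source, extChartAt_source]
  exact TangentBundle.mem_chart_source_iff w v

theorem extChartAt_tangent_apply {v w : TangentBundle I Q}
    (hw : w.proj ∈ (extChartAt I v.proj).source) :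
    extChartAt I.tangent v w = (extChartAt I v.proj w.proj,
      (mfderiv I 𝓘(ℝ, E) (extChartAt I v.proj) w.proj w.snd : E)) :=
  Prod.ext rfl (DFunLike.congr_fun (mfderiv_extChartAt_eq_tangentCoordChange hw) w.snd).symm

theorem mfderiv_extChartAt_self_apply (q : Q) (u : E) :
    (mfderiv I 𝓘(ℝ, E) (extChartAt I q) q u : E) = u := by
  have hself : tangentCoordChange I q q q u = u :=
    tangentCoordChange_self (mem_extChartAt_source q)
  exact (DFunLike.congr_fun
    (mfderiv_extChartAt_eq_tangentCoordChange (mem_extChartAt_source q)) u).trans hself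

theorem extChartAt_tangent_self (v : TangentBundle I Q) :
    extChartAt I.tangent v v = (extChartAt I v.proj v.proj, (v.snd : E)) :=
  Prod.ext rfl (tangentCoordChange_self (I := I) (v := v.snd) (mem_extChartAt_source v.proj))

theorem fst_mfderiv_extChartAt_tangent (v : TangentBundle I Q) (a : TangentSpace I.tangent v) :
    (mfderiv I.tangent 𝓘(ℝ, E × E) (extChartAt I.tangent v) v a : E × E).1 =
      (mfderiv I.tangent I (fun w : TangentBundle I Q ↦ w.proj) v a : E) := by
  have hchart : HasMFDerivAt I.tangent 𝓘(ℝ, E × E) (extChartAt I.tangent v) v _ :=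
    (mdifferentiableAt_extChartAt (mem_chart_source _ v)).hasMFDerivAt
  have hfst : HasMFDerivAt 𝓘(ℝ, E × E) 𝓘(ℝ, E) Prod.fst (extChartAt I.tangent v v)
    (ContinuousLinearMap.fst ℝ E E) := hasFDerivAt_fst.hasMFDerivAt
  have hproj : HasMFDerivAt I.tangent I (fun w : TangentBundle I Q ↦ w.proj) v _ :=
    ((Bundle.contMDiff_proj (TangentSpace I) (n := ∞)).mdifferentiableAt (by simp)).hasMFDerivAt
  have hbase : HasMFDerivAt I 𝓘(ℝ, E) (extChartAt I v.proj) v.proj _ :=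
    (mdifferentiableAt_extChartAt (mem_chart_source _ v.proj)).hasMFDerivAt
  exact (DFunLike.congr_fun (hasMFDerivAt_unique (hfst.comp v hchart) (hbase.comp v hproj)) a).trans
    (mfderiv_extChartAt_self_apply v.proj _)

theorem contDiffOn_coordField {Y : ∀ q : Q, TangentSpace I q}
    (hY : ContMDiff I I.tangent ∞ fun q ↦ (⟨q, Y q⟩ : TangentBundle I Q)) (q : Q) :
    ContDiffOn ℝ ∞ (coordField Y q) (extChartAt I q).target := by
  have hchart : ContMDiffOn I.tangent 𝓘(ℝ, E × E) ∞
      (extChartAt I.tangent (⟨q, 0⟩ : TangentBundle I Q)) _ := contMDiffOn_extChartAt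
  have hcomp := hchart.comp (hY.comp_contMDiffOn (contMDiffOn_extChartAt_symm q)) fun x hx ↦ by
    rw [Set.mem_preimage, TangentBundle.mem_chart_source_iff, ← extChartAt_source I]
    exact (extChartAt I q).map_target hx
  refine (contMDiffOn_iff_contDiffOn.1 hcomp).snd.congr fun x hx ↦ ?_
  exact congrArg Prod.snd (extChartAt_tangent_apply (v := (⟨q, 0⟩ : TangentBundle I Q))
    (w := ⟨(extChartAt I q).symm x, Y _⟩) ((extChartAt I q).map_target hx)).symm

theorem contDiffOn_coordLagrangian {L : TangentBundle I Q → ℝ}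
    (hL : ContMDiff I.tangent 𝓘(ℝ, ℝ) ∞ L) (v : TangentBundle I Q) :
    ContDiffOn ℝ ∞ (coordLagrangian L v) (extChartAt I.tangent v).target :=
  contMDiffOn_iff_contDiffOn.1 (hL.comp_contMDiffOn (contMDiffOn_extChartAt_symm v))

theorem coordLagrangian_extChartAt (L : TangentBundle I Q → ℝ) {v w : TangentBundle I Q}
    (hw : w.proj ∈ (extChartAt I v.proj).source) :
    coordLagrangian L v (extChartAt I.tangent v w) = L w :=
  congrArg L ((extChartAt I.tangent v).left_inv (mem_extChartAt_tangent_source.2 hw))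

variable [I.Boundaryless]

theorem contDiffAt_coordLagrangian {L : TangentBundle I Q → ℝ}
    (hL : ContMDiff I.tangent 𝓘(ℝ, ℝ) ∞ L) {v w : TangentBundle I Q}
    (hw : w.proj ∈ (extChartAt I v.proj).source) :
    ContDiffAt ℝ ∞ (coordLagrangian L v) (extChartAt I.tangent v w) :=
  (contDiffOn_coordLagrangian hL v).contDiffAt ((isOpen_extChartAt_target v).mem_nhds
    ((extChartAt I.tangent v).map_source (mem_extChartAt_tangent_source.2 hw)))

theorem momentum_eq_fderiv_coordLagrangian {L : TangentBundle I Q → ℝ}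
    (hL : ContMDiff I.tangent 𝓘(ℝ, ℝ) ∞ L) {v w : TangentBundle I Q}
    (hw : w.proj ∈ (extChartAt I v.proj).source) (y : TangentSpace I w.proj) :
    momentum L w y = fderiv ℝ (coordLagrangian L v) (extChartAt I.tangent v w)
      (0, (mfderiv I 𝓘(ℝ, E) (extChartAt I v.proj) w.proj y : E)) := by
  let x : E := extChartAt I v.proj w.proj
  let u₀ : E := w.snd
  let A : E →L[ℝ] E := mfderiv I 𝓘(ℝ, E) (extChartAt I v.proj) w.proj
  have hfibre : (fun u : E ↦ L ⟨w.proj, u⟩) = fun u : E ↦ coordLagrangian L v (x, A u) := by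
    funext u
    rw [← coordLagrangian_extChartAt L (v := v) (w := ⟨w.proj, u⟩) hw,
      extChartAt_tangent_apply (w := ⟨w.proj, u⟩) hw]
    rfl
  have hpoint : extChartAt I.tangent v w = (x, A u₀) := extChartAt_tangent_apply hw
  have hcoord := ((contDiffAt_coordLagrangian hL hw).differentiableAt (by simp)).hasFDerivAt
  rw [hpoint] at hcoord ⊢
  have hcomp := (hcoord.comp u₀ ((hasFDerivAt_const x u₀).prodMk A.hasFDerivAt)).fderiv
  rw [Function.comp_def, ← hfibre] at hcomp
  exact DFunLike.congr_fun hcomp y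

theorem energy_sub_momentum_eq_localMovingEnergy {L : TangentBundle I Q → ℝ}
    (hL : ContMDiff I.tangent 𝓘(ℝ, ℝ) ∞ L) (Y : ∀ q : Q, TangentSpace I q)
    {v w : TangentBundle I Q} (hw : w.proj ∈ (extChartAt I v.proj).source) :
    energy L w - momentum L w (Y w.proj) =
      localMovingEnergy (coordLagrangian L v) (coordField Y v.proj) (extChartAt I.tangent v w) := by
  rw [energy, sub_right_comm, ← map_sub, momentum_eq_fderiv_coordLagrangian hL hw, map_sub,
    localMovingEnergy, coordLagrangian_extChartAt L hw, extChartAt_tangent_apply hw,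
    coordField_extChartAt Y hw]
  rfl

theorem energy_sub_momentum_eventuallyEq {L : TangentBundle I Q → ℝ}
    (hL : ContMDiff I.tangent 𝓘(ℝ, ℝ) ∞ L) (Y : ∀ q : Q, TangentSpace I q)
    (v : TangentBundle I Q) :
    (fun w ↦ energy L w - momentum L w (Y w.proj)) =ᶠ[𝓝 v]
      localMovingEnergy (coordLagrangian L v) (coordField Y v.proj) ∘ extChartAt I.tangent v := by
  filter_upwards [extChartAt_source_mem_nhds (I := I.tangent) v] with w hw
  exact energy_sub_momentum_eq_localMovingEnergy hL Y (mem_extChartAt_tangent_source.1 hw)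

theorem contDiffAt_localMovingEnergy_coord {L : TangentBundle I Q → ℝ}
    (hL : ContMDiff I.tangent 𝓘(ℝ, ℝ) ∞ L) {Y : ∀ q : Q, TangentSpace I q}
    (hY : ContMDiff I I.tangent ∞ fun q ↦ (⟨q, Y q⟩ : TangentBundle I Q))
    (v : TangentBundle I Q) :
    ContDiffAt ℝ ∞ (localMovingEnergy (coordLagrangian L v) (coordField Y v.proj))
      (extChartAt I.tangent v v) := by
  have hcoord := contDiffAt_coordLagrangian hL (mem_extChartAt_source v.proj)
  have hfield : ContDiffAt ℝ ∞ (coordField Y v.proj) (extChartAt I.tangent v v).1 :=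
    (contDiffOn_coordField hY v.proj).contDiffAt
      ((isOpen_extChartAt_target v.proj).mem_nhds (mem_extChartAt_target v.proj))
  exact ((hcoord.fderiv_right (by simp)).clm_apply (contDiffAt_const.prodMk
    (contDiffAt_snd.sub (hfield.comp _ contDiffAt_fst)))).sub hcoord

theorem contMDiff_energy_sub_momentum {L : TangentBundle I Q → ℝ}
    (hL : ContMDiff I.tangent 𝓘(ℝ, ℝ) ∞ L) {Y : ∀ q : Q, TangentSpace I q}
    (hY : ContMDiff I I.tangent ∞ fun q ↦ (⟨q, Y q⟩ : TangentBundle I Q)) :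
    ContMDiff I.tangent 𝓘(ℝ, ℝ) ∞ fun w ↦ energy L w - momentum L w (Y w.proj) := fun v ↦
  ((contDiffAt_localMovingEnergy_coord hL hY v).contMDiffAt.comp v contMDiffAt_extChartAt)
    |>.congr_of_eventuallyEq (energy_sub_momentum_eventuallyEq hL Y v)

theorem mfderiv_energy_sub_momentum {L : TangentBundle I Q → ℝ}
    (hL : ContMDiff I.tangent 𝓘(ℝ, ℝ) ∞ L) {Y : ∀ q : Q, TangentSpace I q}
    (hY : ContMDiff I I.tangent ∞ fun q ↦ (⟨q, Y q⟩ : TangentBundle I Q))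
    (v : TangentBundle I Q) (a : TangentSpace I.tangent v) :
    (mfderiv I.tangent 𝓘(ℝ, ℝ) (fun w ↦ energy L w - momentum L w (Y w.proj)) v a : ℝ) =
      fderiv ℝ (localMovingEnergy (coordLagrangian L v) (coordField Y v.proj))
        (extChartAt I.tangent v v)
        (mfderiv I.tangent 𝓘(ℝ, E × E) (extChartAt I.tangent v) v a : E × E) := by
  have hlocal := ((contDiffAt_localMovingEnergy_coord hL hY v).differentiableAt
    (by simp)).hasFDerivAt.hasMFDerivAt
  have hchart : HasMFDerivAt I.tangent 𝓘(ℝ, E × E) (extChartAt I.tangent v) v _ :=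
    (mdifferentiableAt_extChartAt (mem_chart_source _ v)).hasMFDerivAt
  exact DFunLike.congr_fun ((hlocal.comp v hchart).congr_of_eventuallyEq
    (energy_sub_momentum_eventuallyEq hL Y v)).mfderiv a

end Coordinates

section Noether

variable {E : Type*} [NormedAddCommGroup E] [NormedSpace ℝ E]
  {H : Type*} [TopologicalSpace H] {I : ModelWithCorners ℝ E H}
  {Q : Type*} [TopologicalSpace Q] [ChartedSpace H Q]

variable {Φ : Q → ℝ → Q} {Y : ∀ q : Q, TangentSpace I q}

theorem IsFlow.eventually_mem_extChartAt_source (hflow : IsFlow Φ Y) (q : Q) :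
    ∀ᶠ s in 𝓝 (0 : ℝ), Φ q s ∈ (extChartAt I q).source :=
  ((hflow q).2 0).continuousAt.eventually_mem
    (by rw [(hflow q).1]; exact extChartAt_source_mem_nhds q)

variable [I.Boundaryless]

theorem extChartAt_tangentMap [IsManifold I 1 Q]
    {E' : Type*} [NormedAddCommGroup E'] [NormedSpace ℝ E']
    {H' : Type*} [TopologicalSpace H'] {I' : ModelWithCorners ℝ E' H'}
    {Q' : Type*} [TopologicalSpace Q'] [ChartedSpace H' Q'] [IsManifold I' ∞ Q']
    {f : Q → Q'} {v : TangentBundle I Q} {w : TangentBundle I' Q'}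
    (hf : MDifferentiableAt I I' f v.proj) (hsource : f v.proj ∈ (extChartAt I' w.proj).source) :
    extChartAt I'.tangent w (tangentMap I I' f v) = (extChartAt I' w.proj (f v.proj),
      (fderiv ℝ (extChartAt I' w.proj ∘ f ∘ (extChartAt I v.proj).symm)
        (extChartAt I v.proj v.proj) v.snd : E')) := by
  have hchart := mdifferentiableAt_extChartAt_of_mem hsource
  have hcoord : mfderiv I 𝓘(ℝ, E') (extChartAt I' w.proj ∘ f) v.proj =
      fderiv ℝ (extChartAt I' w.proj ∘ f ∘ (extChartAt I v.proj).symm)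
        (extChartAt I v.proj v.proj) := by
    rw [(hchart.comp v.proj hf).mfderiv, I.range_eq_univ, fderivWithin_univ,
      writtenInExtChartAt, extChartAt_model_space_eq_id]
    rfl
  rw [mfderiv_comp v.proj hchart hf] at hcoord
  exact (extChartAt_tangent_apply (w := tangentMap I I' f v) hsource).trans
    (congrArg (Prod.mk (extChartAt I' w.proj (f v.proj))) (DFunLike.congr_fun hcoord v.snd))

/-- The local representative of a flow `Φ` in the chart around `q`, as a function of
`(time, position)`. -/
noncomputable def coordFlow (I : ModelWithCorners ℝ E H) (Φ : Q → ℝ → Q) (q : Q) (p : ℝ × E) : E :=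
  extChartAt I q (Φ ((extChartAt I q).symm p.2) p.1)

variable [IsManifold I ∞ Q]

theorem contDiffAt_coordFlow
    (hΦ : ContMDiff (I.prod 𝓘(ℝ, ℝ)) I ∞ fun p : Q × ℝ ↦ Φ p.1 p.2) {q : Q} {s : ℝ} {x : E}
    (hx : x ∈ (extChartAt I q).target)
    (hsource : Φ ((extChartAt I q).symm x) s ∈ (extChartAt I q).source) :
    ContDiffAt ℝ ∞ (coordFlow I Φ q) (s, x) := by
  have hsymm : ContMDiffAt 𝓘(ℝ, E) I ∞ (extChartAt I q).symm x :=
    (contMDiffOn_extChartAt_symm q).contMDiffAt ((isOpen_extChartAt_target q).mem_nhds hx)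
  have hsnd : ContMDiffAt 𝓘(ℝ, ℝ × E) 𝓘(ℝ, E) ∞ Prod.snd (s, x) :=
    contDiff_snd.contMDiff.contMDiffAt
  have hfst : ContMDiffAt 𝓘(ℝ, ℝ × E) 𝓘(ℝ, ℝ) ∞ Prod.fst (s, x) :=
    contDiff_fst.contMDiff.contMDiffAt
  have hchart : ContMDiffAt I 𝓘(ℝ, E) ∞ (extChartAt I q) (Φ ((extChartAt I q).symm x) s) :=
    contMDiffAt_extChartAt' (by rwa [← extChartAt_source I])
  have hpair : ContMDiffAt 𝓘(ℝ, ℝ × E) (I.prod 𝓘(ℝ, ℝ)) ∞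
      (fun p : ℝ × E ↦ ((extChartAt I q).symm p.2, p.1)) (s, x) :=
    (ContMDiffAt.comp (s, x) (g := (extChartAt I q).symm) hsymm hsnd).prodMk hfst
  exact contMDiffAt_iff_contDiffAt.1
    (ContMDiffAt.comp (s, x) (g := extChartAt I q) hchart (hΦ.contMDiffAt.comp (s, x) hpair))

theorem fderiv_coordFlow_apply_one
    (hΦ : ContMDiff (I.prod 𝓘(ℝ, ℝ)) I ∞ fun p : Q × ℝ ↦ Φ p.1 p.2) (hflow : IsFlow Φ Y)
    {q : Q} {x : E} (hx : x ∈ (extChartAt I q).target) :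
    fderiv ℝ (coordFlow I Φ q) (0, x) (1, 0) = coordField Y q x := by
  have hzero : Φ ((extChartAt I q).symm x) 0 = (extChartAt I q).symm x := (hflow _).1
  have hsource : Φ ((extChartAt I q).symm x) 0 ∈ (extChartAt I q).source := by
    rw [hzero]
    exact (extChartAt I q).map_target hx
  have hvelocity := hasDerivWithinAt_comp_curve (mdifferentiableAt_extChartAt_of_mem hsource)
    (((hflow ((extChartAt I q).symm x)).2 0).hasMFDerivWithinAt (s := Set.univ))
  have hpartial := hasDerivAt_comp_prodMk_right
    ((contDiffAt_coordFlow hΦ hx hsource).differentiableAt (by simp))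
  rw [hpartial.unique (hasDerivWithinAt_univ.1 hvelocity), ← coordField_extChartAt Y hsource, hzero,
    (extChartAt I q).right_inv hx]

theorem extChartAt_tangentMap_flow
    (hΦ : ContMDiff (I.prod 𝓘(ℝ, ℝ)) I ∞ fun p : Q × ℝ ↦ Φ p.1 p.2) (v : TangentBundle I Q) {s : ℝ}
    (hsource : Φ v.proj s ∈ (extChartAt I v.proj).source) :
    extChartAt I.tangent v (tangentMap I I (Φ · s) v) =
      (coordFlow I Φ v.proj (s, extChartAt I v.proj v.proj),
        fderiv ℝ (coordFlow I Φ v.proj) (s, extChartAt I v.proj v.proj) (0, (v.snd : E))) := by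
  let x : E := extChartAt I v.proj v.proj
  have hinv : (extChartAt I v.proj).symm x = v.proj := extChartAt_to_inv v.proj
  have hΦs : MDifferentiableAt I I (Φ · s) v.proj :=
    (hΦ.comp (contMDiff_id.prodMk contMDiff_const)).mdifferentiableAt (by simp)
  have hcoord : DifferentiableAt ℝ (coordFlow I Φ v.proj) (s, x) :=
    (contDiffAt_coordFlow hΦ (mem_extChartAt_target v.proj)
      (by rwa [hinv])).differentiableAt (by simp)
  have hspace := (hcoord.hasFDerivAt.comp x (hasFDerivAt_prodMk_right s x)).fderiv
  refine (extChartAt_tangentMap hΦs hsource).trans (Prod.ext ?_ ?_)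
  · exact congrArg (fun q ↦ extChartAt I v.proj (Φ q s)) hinv.symm
  · exact DFunLike.congr_fun hspace (v.snd : E)

theorem hasDerivAt_extChartAt_tangentMap_flow
    (hΦ : ContMDiff (I.prod 𝓘(ℝ, ℝ)) I ∞ fun p : Q × ℝ ↦ Φ p.1 p.2) (hflow : IsFlow Φ Y)
    (v : TangentBundle I Q) :
    HasDerivAt (fun s ↦ extChartAt I.tangent v (tangentMap I I (Φ · s) v))
      (coordField Y v.proj (extChartAt I v.proj v.proj),
        fderiv ℝ (coordField Y v.proj) (extChartAt I v.proj v.proj) (v.snd : E)) 0 := by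
  let x : E := extChartAt I v.proj v.proj
  have hx : x ∈ (extChartAt I v.proj).target := mem_extChartAt_target v.proj
  have hzero : Φ ((extChartAt I v.proj).symm x) 0 = v.proj :=
    (hflow _).1.trans (extChartAt_to_inv v.proj)
  have hcoord : ContDiffAt ℝ ∞ (coordFlow I Φ v.proj) (0, x) :=
    contDiffAt_coordFlow hΦ hx (by rw [hzero]; exact mem_extChartAt_source v.proj)
  have hvelocity : (fun x' ↦ fderiv ℝ (coordFlow I Φ v.proj) (0, x') (1, 0)) =ᶠ[𝓝 x]
      coordField Y v.proj := by
    filter_upwards [(isOpen_extChartAt_target v.proj).mem_nhds hx] with x' hx'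
    exact fderiv_coordFlow_apply_one hΦ hflow hx'
  have hlift := hasDerivAt_tangentLift (hcoord.of_le ENat.LEInfty.out) (v.snd : E)
  rw [hvelocity.eq_of_nhds, hvelocity.fderiv_eq] at hlift
  refine hlift.congr_of_eventuallyEq ?_
  exact (hflow.eventually_mem_extChartAt_source v.proj).mono fun s hs ↦
    extChartAt_tangentMap_flow hΦ v hs

theorem fderiv_coordLagrangian_eq_zero_of_invariant {L : TangentBundle I Q → ℝ}
    (hL : ContMDiff I.tangent 𝓘(ℝ, ℝ) ∞ L)
    (hΦ : ContMDiff (I.prod 𝓘(ℝ, ℝ)) I ∞ fun p : Q × ℝ ↦ Φ p.1 p.2) (hflow : IsFlow Φ Y)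
    {v : TangentBundle I Q} (hinv : ∀ s, L (tangentMap I I (Φ · s) v) = L v) :
    fderiv ℝ (coordLagrangian L v) (extChartAt I.tangent v v)
      (coordField Y v.proj (extChartAt I v.proj v.proj),
        fderiv ℝ (coordField Y v.proj) (extChartAt I v.proj v.proj) (v.snd : E)) = 0 := by
  have hid : tangentMap I I (Φ · 0) v = v := by
    rw [show (Φ · 0) = id from funext fun q ↦ (hflow q).1, tangentMap_id, id]
  have hcoord : HasFDerivAt (coordLagrangian L v) _
      (extChartAt I.tangent v (tangentMap I I (Φ · 0) v)) :=
    ((contDiffAt_coordLagrangian hL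
      (hid.symm ▸ mem_extChartAt_source v.proj)).differentiableAt (by simp)).hasFDerivAt
  have hchain := hcoord.comp_hasDerivAt 0 (hasDerivAt_extChartAt_tangentMap_flow hΦ hflow v)
  have hconst := (hasDerivAt_const (0 : ℝ) (L v)).congr_of_eventuallyEq
    ((hflow.eventually_mem_extChartAt_source v.proj).mono fun s hs ↦ (coordLagrangian_extChartAt L
      (w := tangentMap I I (Φ · s) v) hs).trans (hinv s))
  rw [hid] at hchain
  exact hchain.unique hconst

theorem mfderiv_energy_sub_momentum_of_invariant {L : TangentBundle I Q → ℝ}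
    (hL : ContMDiff I.tangent 𝓘(ℝ, ℝ) ∞ L)
    (hΦ : ContMDiff (I.prod 𝓘(ℝ, ℝ)) I ∞ fun p : Q × ℝ ↦ Φ p.1 p.2) (hflow : IsFlow Φ Y)
    {v : TangentBundle I Q} (hinv : ∀ s, L (tangentMap I I (Φ · s) v) = L v)
    {a : TangentSpace I.tangent v}
    (ha : mfderiv I.tangent I (fun w : TangentBundle I Q ↦ w.proj) v a = v.snd) :
    (mfderiv I.tangent 𝓘(ℝ, ℝ) (fun w ↦ energy L w - momentum L w (Y w.proj)) v a : ℝ) =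
      lagrangeCovector L v a (v.snd - Y v.proj) := by
  have hY := hflow.contMDiff_vectorField hΦ
  let x : E := extChartAt I v.proj v.proj
  let y : E := v.snd
  let Yq : E := Y v.proj
  let dz : E × E := mfderiv I.tangent 𝓘(ℝ, E × E) (extChartAt I.tangent v) v a
  have hz : extChartAt I.tangent v v = (x, y) := extChartAt_tangent_self v
  have hdz : dz = (y, dz.2) := Prod.ext ((fst_mfderiv_extChartAt_tangent v a).trans ha) rfl
  have hℓ : ContDiffAt ℝ 2 (coordLagrangian L v) (extChartAt I.tangent v v) :=
    (contDiffAt_coordLagrangian hL (mem_extChartAt_source v.proj)).of_le ENat.LEInfty.out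
  have hfield : DifferentiableAt ℝ (coordField Y v.proj) x :=
    ((contDiffOn_coordField hY v.proj).contDiffAt ((isOpen_extChartAt_target v.proj).mem_nhds
      (mem_extChartAt_target v.proj))).differentiableAt (by simp)
  have hfield_self : coordField Y v.proj x = Yq :=
    (coordField_extChartAt Y (mem_extChartAt_source v.proj)).trans
      (mfderiv_extChartAt_self_apply v.proj Yq)
  have hcovector : lagrangeCovector L v a (v.snd - Y v.proj) =
      eulerLagrange (coordLagrangian L v) (extChartAt I.tangent v v) dz
        (y - coordField Y v.proj x) := by
    rw [hfield_self]
    exact congrArg (eulerLagrange (coordLagrangian L v) (extChartAt I.tangent v v) dz)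
      (mfderiv_extChartAt_self_apply v.proj (y - Yq))
  have hsymmetry := fderiv_coordLagrangian_eq_zero_of_invariant hL hΦ hflow hinv
  rw [hz] at hℓ hsymmetry
  have hlocal : fderiv ℝ (localMovingEnergy (coordLagrangian L v) (coordField Y v.proj))
      (extChartAt I.tangent v v) dz = eulerLagrange (coordLagrangian L v)
        (extChartAt I.tangent v v) dz (y - coordField Y v.proj x) := by
    rw [hz, hdz, fderiv_localMovingEnergy hℓ hfield, hsymmetry, sub_zero]
  exact (mfderiv_energy_sub_momentum hL hY v a).trans (hlocal.trans hcovector.symm)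

end Noether

end MovingEnergy

open MovingEnergy in
theorem theorem2_general
    {E : Type*} [NormedAddCommGroup E] [NormedSpace ℝ E]
    {H : Type*} [TopologicalSpace H] {I : ModelWithCorners ℝ E H} [I.Boundaryless]
    {Q : Type*} [TopologicalSpace Q] [T2Space Q] [ChartedSpace H Q] [IsManifold I ∞ Q]
    {L : TangentBundle I Q → ℝ} (hL : ContMDiff I.tangent 𝓘(ℝ, ℝ) ∞ L)
    {ξ : ∀ q : Q, TangentSpace I q} {D : ∀ q : Q, Submodule ℝ (TangentSpace I q)}
    {X : ∀ v : TangentBundle I Q, TangentSpace I.tangent v}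
    (hX : ∀ v ∈ constraintSubmanifold ξ D,
      mfderiv I.tangent I (fun w : TangentBundle I Q ↦ w.proj) v (X v) = v.snd)
    (hlagrange : ∀ v ∈ constraintSubmanifold ξ D, ∀ w ∈ D v.proj,
      lagrangeCovector L v (X v) w = 0)
    {Φ : Q → ℝ → Q} {Y : ∀ q : Q, TangentSpace I q}
    (hΦ : ContMDiff (I.prod 𝓘(ℝ, ℝ)) I ∞ fun p : Q × ℝ ↦ Φ p.1 p.2) (hflow : IsFlow Φ Y)
    (hinv : ∀ v ∈ constraintSubmanifold ξ D, ∀ t, L (tangentMap I I (Φ · t) v) = L v)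
    (hY : ∀ q, Y q - ξ q ∈ D q) :
    IsFirstIntegral (constraintSubmanifold ξ D) X
      (fun v ↦ energy L v - momentum L v (Y v.proj)) ∧
    (∃! C : TimeDependentDiffeo I I Q Q, IsFlow C.map Y) ∧
    ∀ C : TimeDependentDiffeo I I Q Q, IsFlow C.map Y →
      ∀ (v : TangentBundle I Q) (t : ℝ),
        movingEnergy (fun z ↦ L z.1) C (v, t) =
          energy L v - momentum L v (Y v.proj) := by
  have hsmooth := contMDiff_energy_sub_momentum hL (hflow.contMDiff_vectorField hΦ)
  refine ⟨⟨hsmooth.contMDiffOn, fun γ s hs hγ hM t₁ ht₁ t₂ ht₂ ↦ ?_⟩,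
    hflow.existsUnique_timeDependentDiffeo hΦ, fun C hC v t ↦ movingEnergy_eq hL hC v t⟩
  refine eq_of_isMIntegralCurveOn_of_mfderiv_eq_zero hs hγ
    (fun t _ ↦ hsmooth.mdifferentiableAt (by simp)) (fun t ht ↦ ?_) ht₁ ht₂
  have hv := hM t ht
  have hmem : (γ t).snd - Y (γ t).proj ∈ D (γ t).proj := by
    rw [← sub_sub_sub_cancel_right _ _ (ξ (γ t).proj)]
    exact (D _).sub_mem hv (hY _)
  exact (mfderiv_energy_sub_momentum_of_invariant hL hΦ hflow (hinv _ hv)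
    (hX _ hv)).trans (hlagrange _ hv _ hmem)

theorem theorem2
    {E : Type*} [NormedAddCommGroup E] [NormedSpace ℝ E] [FiniteDimensional ℝ E]
    {H : Type*} [TopologicalSpace H] (I : ModelWithCorners ℝ E H) [I.Boundaryless]
    {Q : Type*} [TopologicalSpace Q] [T2Space Q] [ChartedSpace H Q] [IsManifold I ∞ Q]
    {F : Type*} [NormedAddCommGroup F] [NormedSpace ℝ F] [FiniteDimensional ℝ F]
    {K : Type*} [TopologicalSpace K] (J : ModelWithCorners ℝ F K) [J.Boundaryless]
    {G : Type*} [TopologicalSpace G] [T2Space G] [ChartedSpace K G] [Group G] [LieGroup J ∞ G]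
    [MulAction G Q] [ContMDiffSMul J I ∞ G Q]
    (S : MovingEnergy.NonholonomicData I Q)
    (X : ∀ v : TangentBundle I Q, TangentSpace I.tangent v)
    (hX : S.IsNonholonomicSystem X)
    (H1 : ∀ (g : G) (v : TangentBundle I Q), S.L (tangentMap I I (fun q : Q ↦ g • q) v) = S.L v)
    (H2 : ∀ (g : G) (q : Q), S.D (g • q) =
      (S.D q).map (mfderiv I I (fun q' : Q ↦ g • q') q).toLinearMap)
    (η : GroupLieAlgebra J G)
    (H3 : ∀ q : Q, MovingEnergy.infinitesimalGenerator I η q - S.ξ q ∈ S.D q) :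
    MovingEnergy.IsFirstIntegral S.M₀ X
      (fun v ↦ MovingEnergy.energy S.L v - MovingEnergy.momentumMap S.L η v) ∧
    (∃! C : MovingEnergy.TimeDependentDiffeo I I Q Q,
      MovingEnergy.IsFlow C.map (MovingEnergy.infinitesimalGenerator I η)) ∧
    ∀ C : MovingEnergy.TimeDependentDiffeo I I Q Q,
      MovingEnergy.IsFlow C.map (MovingEnergy.infinitesimalGenerator I η) →
        ∀ (v : TangentBundle I Q) (t : ℝ),
          MovingEnergy.movingEnergy (fun z ↦ S.L z.1) C (v, t) =
            MovingEnergy.energy S.L v - MovingEnergy.momentumMap S.L η v := by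
  have := FiniteDimensional.complete ℝ F
  obtain ⟨R, hR⟩ := hX.lagrange
  exact theorem2_general S.smooth_L hX.second_order
    (fun v hv w hw ↦ by rw [(hR v hv).2, (hR v hv).1 w hw])
    (MovingEnergy.contMDiff_lieExp_smul_smul I η) (MovingEnergy.isFlow_lieExp_smul_smul I η)
    (fun v _ t ↦ H1 _ v) H3
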